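/- Let $C$ be a non-trivial finite group. For a finitely generated group $\Gamma$, let $\Lambda_\Gamma$ be the set of finite index subgroups of $\Gamma$, directed by reverse inclusion, and set $$\widetilde{V_C}(\Gamma)=\varlimsup_{H\in\Lambda_\Gamma}\frac{\frac{1}{\log|C|}\log|\mathrm{Hom}(H,C)|-1}{[\Gamma:H]}=\inf_{H\in\Lambda_\Gamma}\ \sup_{K\in\Lambda_\Gamma,\,K\le H}\frac{\frac{1}{\log|C|}\log|\mathrm{Hom}(K,C)|-1}{[\Gamma:K]}$$ if $\Gamma$ is infinite, and $\widetilde{V_C}(\Gamma)=-\frac{1}{|\Gamma|}$ if $\Gamma$ is finite; here $\mathrm{Hom}(H,C)$ is the set of group homomorphisms from $H$ to $C$. Let $G$ be the fundamental group (with respect to a maximal tree) of a finite, non-empty, connected graph of groups $(\mathcal G,Y)$ with finitely generated vertex groups $G_u$, $u\in VY$, and finite edge groups $G_e$, $e\in EY$, where $EY$ is the set of geometric (unoriented) edges of $Y$, so that each edge is counted once; loops and multiple edges are allowed. Assume that each vertex group is residually finite or virtually torsion free (that is, it has a finite index subgroup without non-trivial elements of finite order). Then $$\widetilde{V_C}(G)=\sum_{u\in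 VY}\widetilde{V_C}(G_u)+\sum_{e\in EY}\frac{1}{|G_e|}.$$ -/

import Mathlib

universe uV uE uG uF

/-- A graph of groups over a graph with vertex set `V` and set of geometric (unoriented) edges `E`;
loops and multiple edges are allowed. Every geometric edge occurs once in `E`, with an arbitrarily
chosen orientation from `src e` to `tgt e`. Every edge group comes with monomorphisms into the
vertex groups of the two end points. -/
structure GraphOfGroups (V : Type uV) (E : Type uE) where
  /-- initial vertex of an edge -/
  src : E → V
  /-- terminal vertex of an edge -/
  tgt : E → V
  /-- the vertex groups -/
  vertexGroup : V → Type uG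
  /-- the edge groups -/
  edgeGroup : E → Type uF
  [vertexGroupInst : ∀ v, Group (vertexGroup v)]
  [edgeGroupInst : ∀ e, Group (edgeGroup e)]
  /-- inclusion of an edge group into the group of the initial vertex -/
  srcHom : ∀ e, edgeGroup e →* vertexGroup (src e)
  /-- inclusion of an edge group into the group of the terminal vertex -/
  tgtHom : ∀ e, edgeGroup e →* vertexGroup (tgt e)
  srcHom_injective : ∀ e, Function.Injective (srcHom e)
  tgtHom_injective : ∀ e, Function.Injective (tgtHom e)

namespace GraphOfGroups

attribute [instance] GraphOfGroups.vertexGroupInst GraphOfGroups.edgeGroupInst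

variable {V : Type uV} {E : Type uE}

/-- Two vertices are joined by an (unoriented) path all of whose edges lie in `T`. -/
def Joined (𝒢 : GraphOfGroups.{uV, uE, uG, uF} V E) (T : Set E) : V → V → Prop :=
  Relation.EqvGen fun u v => ∃ e ∈ T, 𝒢.src e = u ∧ 𝒢.tgt e = v

/-- `T` is the edge set of a maximal (spanning) tree of the underlying graph: the subgraph with all
vertices and with edge set `T` is non-empty, connected, and without circuits (no edge of `T` joins
two vertices that are still joined after the removal of this edge). If there is such a `T`, the
underlying graph is non-empty and connected. -/
structure IsMaximalTree (𝒢 : GraphOfGroups.{uV, uE, uG, uF} V E) (T : Set E) : Prop where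
  nonempty : Nonempty V
  connected : ∀ u v, 𝒢.Joined T u v
  acyclic : ∀ e ∈ T, ¬ 𝒢.Joined (T \ {e}) (𝒢.src e) (𝒢.tgt e)

/-- The free product of all vertex groups and of the free group on the edges. -/
abbrev BigFreeProduct (𝒢 : GraphOfGroups.{uV, uE, uG, uF} V E) : Type _ :=
  Monoid.Coprod (Monoid.CoprodI 𝒢.vertexGroup) (FreeGroup E)

/-- A vertex group in the big free product. -/
def ofVertex (𝒢 : GraphOfGroups.{uV, uE, uG, uF} V E) (v : V) :
    𝒢.vertexGroup v →* 𝒢.BigFreeProduct :=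
  Monoid.Coprod.inl.comp Monoid.CoprodI.of

/-- The letter of an edge in the big free product. -/
def letter (𝒢 : GraphOfGroups.{uV, uE, uG, uF} V E) (e : E) : 𝒢.BigFreeProduct :=
  Monoid.Coprod.inr (FreeGroup.of e)

/-- The relators of the fundamental group: `t_e · a^{tgt} · t_e⁻¹ = a^{src}` for every edge `e` and
every `a` in its edge group, and `t_e = 1` for every edge `e` of `T`. -/
def relators (𝒢 : GraphOfGroups.{uV, uE, uG, uF} V E) (T : Set E) : Set 𝒢.BigFreeProduct :=
  {x | ∃ (e : E) (a : 𝒢.edgeGroup e),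
      x = 𝒢.letter e * 𝒢.ofVertex (𝒢.tgt e) (𝒢.tgtHom e a) * (𝒢.letter e)⁻¹ *
        (𝒢.ofVertex (𝒢.src e) (𝒢.srcHom e a))⁻¹} ∪
  {x | ∃ e ∈ T, x = 𝒢.letter e}

/-- The fundamental group `π₁(𝒢, Y, T)` of a graph of groups with respect to a maximal tree `T`. -/
def FundGroup (𝒢 : GraphOfGroups.{uV, uE, uG, uF} V E) (T : Set E) : Type _ :=
  𝒢.BigFreeProduct ⧸ Subgroup.normalClosure (𝒢.relators T)

instance (𝒢 : GraphOfGroups.{uV, uE, uG, uF} V E) (T : Set E) : Group (𝒢.FundGroup T) :=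
  inferInstanceAs (Group (𝒢.BigFreeProduct ⧸ Subgroup.normalClosure (𝒢.relators T)))

end GraphOfGroups

/-- Some subgroup of finite index has no non-trivial element of finite order. (`IsMulTorsionFree`
asks for unique roots, which is stronger for non-commutative groups.) -/
def IsVirtuallyTorsionFree (G : Type*) [Group G] : Prop :=
  ∃ H : Subgroup G, H.FiniteIndex ∧ ∀ g ∈ H, IsOfFinOrder g → g = 1

/-- `V_C(G)`, the upper limit of `(log |Hom(K, C)| / log |C| - 1) / [G : K]` over the finite index
subgroups `K` of `G`, directed by reverse inclusion, as an extended real number: the infimum over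
finite index subgroups `H` of the supremum over finite index subgroups `K` contained in `H`. -/
noncomputable def homVolume (C : Type*) [Group C] (G : Type*) [Group G] : EReal :=
  ⨅ (H : Subgroup G) (_ : H.FiniteIndex), ⨆ (K : Subgroup G) (_ : K.FiniteIndex) (_ : K ≤ H),
    (((1 / Real.log (Nat.card C) * Real.log (Nat.card (K →* C)) - 1) / K.index : ℝ) : EReal)

open Classical in
/-- The modified volume: `-1 / |G|` for finite `G`, and `V_C(G)` for infinite `G`. -/
noncomputable def modifiedHomVolume (C : Type*) [Group C] (G : Type*) [Group G] : EReal :=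
  if Finite G then ((-1 / Nat.card G : ℝ) : EReal) else homVolume C G

/-!
Lifts of a permutation representation of `Γ` on a finite set `X` to the wreath product of `C` by the
permutations of `X` are crossed homomorphisms. By Shapiro's lemma, on an orbit `Γ / K` they are
homomorphisms `K → C` up to a change of coordinates, so the logarithm of their number to base `|C|`
is the sum over `x : X` of one plus the density `homDensity C K` of the stabilizer `K` of `x`.

A lift of a representation of the fundamental group consists of lifts on the vertex groups and of an
intertwiner for every edge, up to changes of coordinates at the vertices. An edge group that acts
freely leaves `|C| ^ (|X| / |G_e|)` choices for the intertwiner. Hence the sum over `X` of the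
densities of the stabilizers is additive over the vertex groups, with the correction `|X| / |G_e|`
for every edge.

For the upper bound, this is applied to the cosets of a small subgroup of the fundamental group. For
the lower bound, near optimal subgroups of the vertex groups are realized, up to conjugation, as
stabilizers of a representation of the fundamental group: the product of the coset spaces is an
action of every vertex group, and two free actions of an edge group on the same finite set are
conjugate. Some point then has a stabilizer whose density is at least the average.
-/

open scoped Pointwise Topology

section HomDensity

variable (C : Type*) [Group C] {G : Type*} [Group G]

instance finite_monoidHom_of_fg [Finite C] [Group.FG G] : Finite (G →* C) := by
  obtain ⟨S, -, hS⟩ := Group.rank_spec G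
  exact .of_injective (fun (f : G →* C) (s : S) => f s) fun f f' h =>
    MonoidHom.eq_of_eqOn_dense hS fun s hs => congrFun h ⟨s, hs⟩

theorem card_monoidHom_le_card_pow_rank [Finite C] [Group.FG G] :
    Nat.card (G →* C) ≤ Nat.card C ^ Group.rank G := by
  obtain ⟨S, hcard, hS⟩ := Group.rank_spec G
  have hinj : Function.Injective fun (f : G →* C) (s : S) => f s := fun f f' h =>
    MonoidHom.eq_of_eqOn_dense hS fun s hs => congrFun h ⟨s, hs⟩
  simpa [Nat.card_fun, hcard] using Nat.card_le_card_of_injective _ hinj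

/-- The term `(log |Hom(K, C)| / log |C| - 1) / [G : K]` whose upper limit over the finite index
subgroups `K` of `G` is `homVolume C G`. -/
noncomputable def homDensity (K : Subgroup G) : ℝ :=
  (Real.logb (Nat.card C) (Nat.card (K →* C)) - 1) / K.index

theorem homDensity_map_equiv {G' : Type*} [Group G'] (f : G ≃* G') (K : Subgroup G) :
    homDensity C (K.map f.toMonoidHom) = homDensity C K := by
  have hHom : Nat.card (K.map f.toMonoidHom →* C) = Nat.card (K →* C) :=
    Nat.card_congr (f.subgroupMap K).symm.monoidHomCongrLeftEquiv
  have hindex : (K.map f.toMonoidHom).index = K.index := K.index_map_equiv f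
  rw [homDensity, homDensity, hHom, hindex]

theorem homDensity_conj_smul (g : G) (K : Subgroup G) :
    homDensity C (MulAut.conj g • K) = homDensity C K :=
  homDensity_map_equiv C (MulAut.conj g) K

theorem homDensity_bot : homDensity C (⊥ : Subgroup G) = -1 / Nat.card G := by
  simp [homDensity]

theorem neg_one_le_homDensity (K : Subgroup G) : -1 ≤ homDensity C K := by
  have hlog : 0 ≤ Real.logb (Nat.card C) (Nat.card (K →* C)) :=
    div_nonneg (Real.log_natCast_nonneg _) (Real.log_natCast_nonneg _)
  have hindex : (K.index : ℝ)⁻¹ ≤ 1 := Nat.cast_inv_le_one _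
  calc (-1 : ℝ) ≤ -1 / K.index := by rw [neg_div, one_div]; linarith
    _ ≤ homDensity C K := by rw [homDensity]; gcongr; linarith

theorem one_lt_natCast_card (C : Type*) [Finite C] [Nontrivial C] : (1 : ℝ) < Nat.card C := by
  exact_mod_cast Finite.one_lt_card

theorem homDensity_le_rank [Finite C] [Nontrivial C] [Group.FG G] (K : Subgroup G) [K.FiniteIndex] :
    homDensity C K ≤ Group.rank G := by
  have hindex : (0 : ℝ) < K.index := by exact_mod_cast Nat.pos_of_ne_zero K.index_ne_zero_of_finite
  have hcard : Nat.card (K →* C) ≤ Nat.card C ^ (K.index * Group.rank G) :=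
    (card_monoidHom_le_card_pow_rank C).trans
      (Nat.pow_le_pow_right Nat.card_pos K.rank_le_index_mul_rank)
  have hlog : Real.logb (Nat.card C) (Nat.card (K →* C)) ≤ K.index * Group.rank G := by
    rw [Real.logb_le_iff_le_rpow (one_lt_natCast_card C) (by exact_mod_cast Nat.card_pos)]
    exact_mod_cast hcard
  rw [homDensity, div_le_iff₀ hindex]
  linarith

end HomDensity

section PointStabilizer

variable {G H X : Type*} [Group G] [Group H]

theorem exists_mulAction_eq_toPermHom (ρ : G →* Equiv.Perm X) :
    ∃ _ : MulAction G X, ρ = MulAction.toPermHom G X :=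
  ⟨.compHom X ρ, MonoidHom.ext fun _ => Equiv.ext fun _ => rfl⟩

/-- The stabilizer of a point under the action given by a homomorphism to a permutation group. -/
def pointStabilizer (ρ : G →* Equiv.Perm X) (x : X) : Subgroup G :=
  (MulAction.stabilizer (Equiv.Perm X) x).comap ρ

@[simp]
theorem mem_pointStabilizer {ρ : G →* Equiv.Perm X} {x : X} {g : G} :
    g ∈ pointStabilizer ρ x ↔ ρ g x = x :=
  Iff.rfl

theorem pointStabilizer_comp (ρ : G →* Equiv.Perm X) (f : H →* G) (x : X) :
    pointStabilizer (ρ.comp f) x = (pointStabilizer ρ x).comap f :=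
  rfl

theorem pointStabilizer_toPermHom [MulAction G X] (x : X) :
    pointStabilizer (MulAction.toPermHom G X) x = MulAction.stabilizer G x :=
  rfl

instance finiteIndex_comap (f : H →* G) (K : Subgroup G) [K.FiniteIndex] :
    (K.comap f).FiniteIndex :=
  ⟨fun h => K.index_ne_zero_of_finite
    (K.index_eq_zero_of_relIndex_eq_zero (K.index_comap f ▸ h))⟩

instance [Finite X] (ρ : G →* Equiv.Perm X) (x : X) : (pointStabilizer ρ x).FiniteIndex :=
  finiteIndex_comap ρ _

theorem exists_stabilizer_quotient_eq_conj_smul {K : Subgroup G} (x : G ⧸ K) :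
    ∃ g : G, MulAction.stabilizer G x = MulAut.conj g • K := by
  induction x using QuotientGroup.induction_on with | _ g =>
  refine ⟨g, ?_⟩
  have := MulAction.stabilizer_smul_eq_stabilizer_map_conj g ((1 : G) : G ⧸ K)
  rwa [MulAction.stabilizer_quotient, MulAction.Quotient.smul_coe, smul_eq_mul, mul_one] at this

end PointStabilizer

section Cocycle

/-- The homomorphisms that lift `β` along `p`. -/
abbrev HomLift {W P G : Type*} [Group W] [Group P] [Group G] (p : W →* P) (β : G →* P) : Type _ :=
  {f : G →* W // p.comp f = β}

/-- The permutational wreath product of `C` by all permutations of `X`. -/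
abbrev PermWreath (C X : Type*) [Group C] : Type _ :=
  (X → C) ⋊[mulAutArrow] Equiv.Perm X

instance (C X : Type*) [Group C] [Finite C] [Finite X] : Finite (PermWreath C X) :=
  .of_equiv _ SemidirectProduct.equivProd.symm

/-- The projection of the wreath product onto the permutation group. -/
abbrev PermWreath.proj (C X : Type*) [Group C] : PermWreath C X →* Equiv.Perm X :=
  SemidirectProduct.rightHom

theorem PermWreath.card_ker_proj (C X : Type*) [Group C] [Finite X] :
    Nat.card (PermWreath.proj C X).ker = Nat.card C ^ Nat.card X := by
  rw [← SemidirectProduct.range_inl_eq_ker_rightHom, ← Nat.card_fun]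
  exact Nat.card_congr (MonoidHom.ofInjective SemidirectProduct.inl_injective).toEquiv.symm

theorem card_homLift_pos {C G X : Type*} [Group C] [Finite C] [Group G] [Group.FG G] [Finite X]
    (ρ : G →* Equiv.Perm X) : 0 < Nat.card (HomLift (PermWreath.proj C X) ρ) :=
  have : Nonempty (HomLift (PermWreath.proj C X) ρ) := ⟨⟨SemidirectProduct.inr.comp ρ, rfl⟩⟩
  Nat.card_pos

variable (C G X : Type*) [Group C] [Group G] [MulAction G X]

/-- The crossed homomorphisms from `G` to `X → C`, where `G` acts on functions by
`(g • f) x = f (g⁻¹ • x)`. -/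
@[ext]
structure Cocycle where
  /-- the underlying function -/
  toFun : G → X → C
  map_mul : ∀ g h x, toFun (g * h) x = toFun g x * toFun h (g⁻¹ • x)

instance : CoeFun (Cocycle C G X) fun _ => G → X → C :=
  ⟨Cocycle.toFun⟩

/-- A homomorphism to the wreath product with prescribed permutations amounts to a crossed
homomorphism. -/
def homLiftEquivCocycle :
    HomLift (PermWreath.proj C X) (MulAction.toPermHom G X) ≃ Cocycle C G X where
  toFun f :=
    { toFun := fun g => (f.1 g).left
      map_mul := fun g h x => by
        have hright : (f.1 g).right = MulAction.toPermHom G X g := DFunLike.congr_fun f.2 g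
        rw [map_mul, SemidirectProduct.mul_left, hright]
        rfl }
  invFun c := ⟨MonoidHom.mk' (fun g => ⟨c g, MulAction.toPermHom G X g⟩) fun g h =>
    SemidirectProduct.ext (funext fun x => c.map_mul g h x) (map_mul _ g h), rfl⟩
  left_inv f := Subtype.ext <| MonoidHom.ext fun g =>
    SemidirectProduct.ext rfl (DFunLike.congr_fun f.2 g).symm
  right_inv _ := rfl

namespace Cocycle

variable {C G X}

theorem map_one (c : Cocycle C G X) (x : X) : c 1 x = 1 := by
  simpa using c.map_mul 1 1 x

/-- Transport of crossed homomorphisms along an isomorphism of `G`-sets. -/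
def congr {Y : Type*} [MulAction G Y] (e : Y ≃ X) (he : ∀ (g : G) y, e (g • y) = g • e y) :
    Cocycle C G X ≃ Cocycle C G Y where
  toFun c := ⟨fun g y => c g (e y), fun g h y => by rw [he, c.map_mul]⟩
  invFun c := ⟨fun g x => c g (e.symm x), fun g h x => by
    have he' : e.symm (g⁻¹ • x) = g⁻¹ • e.symm x := by
      rw [Equiv.symm_apply_eq, he, e.apply_symm_apply]
    rw [he', c.map_mul]⟩
  left_inv c := by simp
  right_inv c := by simp

/-- Crossed homomorphisms for a disjoint union of `G`-sets. -/
def sigmaEquiv {ι : Type*} (Y : ι → Type*) [∀ i, MulAction G (Y i)] :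
    Cocycle C G (Σ i, Y i) ≃ ∀ i, Cocycle C G (Y i) where
  toFun c i := ⟨fun g y => c g ⟨i, y⟩, fun g h y => c.map_mul g h ⟨i, y⟩⟩
  invFun c := ⟨fun g y => c y.1 g y.2, fun g h y => (c y.1).map_mul g h y.2⟩
  left_inv _ := rfl
  right_inv _ := rfl

/-- On a transitive `G`-set a crossed homomorphism is, up to a change of coordinates in `X → C`, a
homomorphism on the stabilizer of `x₀`; the factor `C` is the value of the change of coordinates at
`x₀`. The function `m` selects an element of `G` that moves `x₀` to a given point. -/
def prodEquivOfTransitive {x₀ : X} (m : X → G) (hm : ∀ x, m x • x₀ = x) (hm₀ : m x₀ = 1) :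
    Cocycle C G X × C ≃ (MulAction.stabilizer G x₀ →* C) × (X → C) where
  toFun p :=
    (MonoidHom.mk' (fun s => p.2⁻¹ * p.1 s x₀ * p.2) fun s t => by
      have hs : (s : G)⁻¹ • x₀ = x₀ := inv_smul_eq_iff.2 s.2.symm
      simp [p.1.map_mul, hs, mul_assoc],
    fun x => p.1 (m x) x * p.2)
  invFun p :=
    (⟨fun g x => p.2 x * p.1 ⟨(m x)⁻¹ * g * m (g⁻¹ • x), by
        rw [MulAction.mem_stabilizer_iff, mul_smul, hm, mul_smul, smul_inv_smul,
          inv_smul_eq_iff, hm]⟩ * (p.2 (g⁻¹ • x))⁻¹, fun g h x => by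
      simp only [mul_assoc, inv_mul_cancel_left, mul_right_inj]
      rw [← mul_assoc (p.1 _) (p.1 _), ← _root_.map_mul]
      simp [mul_assoc, mul_smul]⟩,
    p.2 x₀)
  left_inv p := by
    obtain ⟨c, a⟩ := p
    have hm' (x : X) : (m x)⁻¹ • x = x₀ := by rw [inv_smul_eq_iff, hm]
    refine Prod.ext (Cocycle.ext (funext₂ fun g x => ?_)) (by simp [hm₀, c.map_one])
    have h := c.map_mul (m x) ((m x)⁻¹ * g * m (g⁻¹ • x)) x
    rw [hm', ← mul_assoc, mul_inv_cancel_left, c.map_mul, ← eq_mul_inv_iff_mul_eq] at h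
    simp [mul_assoc, h]
  right_inv p := by
    obtain ⟨φ, b⟩ := p
    have hs (s : MulAction.stabilizer G x₀) : (s : G)⁻¹ • x₀ = x₀ := inv_smul_eq_iff.2 s.2.symm
    have hm' (x : X) : (m x)⁻¹ • x = x₀ := by rw [inv_smul_eq_iff, hm]
    refine Prod.ext (MonoidHom.ext fun s => ?_) (funext fun x => ?_)
    · simp [hs, hm₀, mul_assoc]
    · have : (⟨1, one_mem _⟩ : MulAction.stabilizer G x₀) = 1 := rfl
      simp [hm', hm₀, this]

instance : Nonempty (Cocycle C G X) :=
  ⟨⟨fun _ _ => 1, by simp⟩⟩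

instance [Finite C] [Finite X] [Group.FG G] : Finite (Cocycle C G X) :=
  .of_equiv _ (homLiftEquivCocycle C G X)

end Cocycle

end Cocycle

section LiftCount

variable {C G X : Type*} [Group C] [Finite C] [Nontrivial C] [Group G] [Group.FG G] [Fintype X]

open Real in
theorem logb_card_cocycle_of_transitive [MulAction G X] [MulAction.IsPretransitive G X]
    [Nonempty X] :
    logb (Nat.card C) (Nat.card (Cocycle C G X)) =
      ∑ x : X, (1 + homDensity C (MulAction.stabilizer G x)) := by
  classical
  obtain ⟨x₀⟩ := ‹Nonempty X›
  choose m hm using fun x => MulAction.exists_smul_eq G x₀ x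
  have hm' (x : X) : Function.update m x₀ 1 x • x₀ = x := by
    obtain rfl | hx := eq_or_ne x x₀ <;> simp [*]
  have hcard := Nat.card_congr
    (Cocycle.prodEquivOfTransitive (C := C) (x₀ := x₀) _ hm' (Function.update_self ..))
  have hindex : (MulAction.stabilizer G x₀).index = Fintype.card X := by
    rw [MulAction.index_stabilizer_of_transitive, Nat.card_eq_fintype_card]
  have : (MulAction.stabilizer G x₀).FiniteIndex := ⟨by simp [hindex]⟩
  have hdensity (x : X) : homDensity C (MulAction.stabilizer G x) =
      homDensity C (MulAction.stabilizer G x₀) := by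
    obtain ⟨g, rfl⟩ := MulAction.exists_smul_eq G x₀ x
    rw [MulAction.stabilizer_smul_eq_stabilizer_map_conj]
    exact homDensity_map_equiv C _ _
  have hlog : logb (Nat.card C) (Nat.card (Cocycle C G X)) + 1 =
      logb (Nat.card C) (Nat.card (MulAction.stabilizer G x₀ →* C)) + Fintype.card X := by
    have hC := one_lt_natCast_card C
    have hC₀ : (Nat.card C : ℝ) ≠ 0 := by positivity
    have hcocycle : (Nat.card (Cocycle C G X) : ℝ) ≠ 0 := by exact_mod_cast Nat.card_pos.ne'
    have hHom : (Nat.card (MulAction.stabilizer G x₀ →* C) : ℝ) ≠ 0 := by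
      exact_mod_cast Nat.card_pos.ne'
    have hlogb := congrArg (fun n : ℕ => logb (Nat.card C) n) hcard
    simpa [Nat.card_prod, Nat.card_fun, logb_mul, logb_pow, logb_self_eq_one, hC, hC₀, hcocycle,
      hHom] using hlogb
  have hX : (Fintype.card X : ℝ) ≠ 0 := by simp
  simp only [hdensity, Finset.sum_const, Finset.card_univ, nsmul_eq_mul]
  rw [homDensity, hindex]
  field_simp
  linarith

open Real in
theorem logb_card_cocycle [MulAction G X] :
    logb (Nat.card C) (Nat.card (Cocycle C G X)) =
      ∑ x : X, (1 + homDensity C (MulAction.stabilizer G x)) := by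
  classical
  have := Fintype.ofFinite (MulAction.orbitRel.Quotient G X)
  have (ω : MulAction.orbitRel.Quotient G X) := Fintype.ofFinite ω.orbit
  let e := (MulAction.selfEquivSigmaOrbits' G X).symm
  have hstab (y) : MulAction.stabilizer G (e y) = MulAction.stabilizer G y.2 := by
    ext g
    exact (Subtype.ext_iff (a1 := g • y.2) (a2 := y.2)).symm
  have hcard := Nat.card_congr ((Cocycle.congr (C := C) e fun (g : G) y => rfl).trans
    (Cocycle.sigmaEquiv fun ω : MulAction.orbitRel.Quotient G X => ω.orbit))
  rw [hcard, Nat.card_pi, Nat.cast_prod, logb_prod, ← e.sum_comp, Fintype.sum_sigma]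
  · refine Finset.sum_congr rfl fun ω _ => ?_
    have : Nonempty ω.orbit :=
      ⟨⟨ω.out, MulAction.orbitRel.Quotient.mem_orbit.2 (Quotient.out_eq' ω)⟩⟩
    simp only [logb_card_cocycle_of_transitive, hstab]
  · exact fun ω _ => by exact_mod_cast Nat.card_pos.ne'

theorem logb_card_homLift (ρ : G →* Equiv.Perm X) :
    Real.logb (Nat.card C) (Nat.card (HomLift (PermWreath.proj C X) ρ)) =
      ∑ x : X, (1 + homDensity C (pointStabilizer ρ x)) := by
  obtain ⟨_, rfl⟩ := exists_mulAction_eq_toPermHom ρ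
  rw [Nat.card_congr (homLiftEquivCocycle C G X)]
  exact logb_card_cocycle

end LiftCount

section FreeAction

variable {Q X : Type*} [Group Q]

theorem bijective_smul_out_of_free [MulAction Q X]
    (hfree : ∀ x, pointStabilizer (MulAction.toPermHom Q X) x = ⊥) :
    Function.Bijective fun p : MulAction.orbitRel.Quotient Q X × Q => p.2 • p.1.out := by
  have hmk (p : MulAction.orbitRel.Quotient Q X × Q) : Quotient.mk'' (p.2 • p.1.out) = p.1 := by
    rw [← Quotient.out_eq' p.1]
    exact Quotient.sound' ⟨p.2, by simp⟩
  refine ⟨fun p p' (h : p.2 • p.1.out = p'.2 • p'.1.out) => ?_, fun x => ?_⟩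
  · have hfst : p.1 = p'.1 := by rw [← hmk p, h, hmk]
    have hmem : p'.2⁻¹ * p.2 ∈ pointStabilizer (MulAction.toPermHom Q X) p.1.out := by
      rw [pointStabilizer_toPermHom, MulAction.mem_stabilizer_iff, mul_smul, h, ← hfst,
        inv_smul_smul]
    rw [hfree, Subgroup.mem_bot, inv_mul_eq_one] at hmem
    exact Prod.ext hfst hmem.symm
  · let ω : MulAction.orbitRel.Quotient Q X := Quotient.mk'' x
    obtain ⟨q, hq : q • x = ω.out⟩ := Quotient.exact' (Quotient.out_eq' ω)
    exact ⟨(ω, q⁻¹), by simp [← hq]⟩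

variable [Finite Q] [Finite X]

theorem exists_equiv_prod_of_free (ρ : Q →* Equiv.Perm X) (hρ : ∀ x, pointStabilizer ρ x = ⊥) :
    ∃ e : X ≃ Fin (Nat.card X / Nat.card Q) × Q, ∀ q x, e (ρ q x) = ((e x).1, q * (e x).2) := by
  obtain ⟨_, rfl⟩ := exists_mulAction_eq_toPermHom ρ
  let e₀ := Equiv.ofBijective _ (bijective_smul_out_of_free hρ)
  have hcard : Nat.card (MulAction.orbitRel.Quotient Q X) = Nat.card X / Nat.card Q := by
    rw [← Nat.card_congr e₀, Nat.card_prod, Nat.mul_div_cancel _ Nat.card_pos]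
  refine ⟨e₀.symm.trans ((Finite.equivFinOfCardEq hcard).prodCongr (.refl Q)), fun q x => ?_⟩
  have he₀ : e₀.symm (q • x) = ((e₀.symm x).1, q * (e₀.symm x).2) := by
    rw [Equiv.symm_apply_eq]
    change _ = (q * (e₀.symm x).2) • (e₀.symm x).1.out
    rw [mul_smul]
    exact congrArg (q • ·) (e₀.apply_symm_apply x).symm
  simp [he₀]

theorem card_dvd_card_of_free (ρ : Q →* Equiv.Perm X) (hρ : ∀ x, pointStabilizer ρ x = ⊥) :
    Nat.card Q ∣ Nat.card X := by
  obtain ⟨e, -⟩ := exists_equiv_prod_of_free ρ hρ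
  rw [Nat.card_congr e, Nat.card_prod]
  exact dvd_mul_left _ _

theorem exists_perm_mul_eq_of_free {ρ₁ ρ₂ : Q →* Equiv.Perm X}
    (hρ₁ : ∀ x, pointStabilizer ρ₁ x = ⊥) (hρ₂ : ∀ x, pointStabilizer ρ₂ x = ⊥) :
    ∃ τ : Equiv.Perm X, ∀ q, τ * ρ₂ q = ρ₁ q * τ := by
  obtain ⟨e₁, he₁⟩ := exists_equiv_prod_of_free ρ₁ hρ₁
  obtain ⟨e₂, he₂⟩ := exists_equiv_prod_of_free ρ₂ hρ₂
  refine ⟨e₂.trans e₁.symm, fun q => Equiv.ext fun x => ?_⟩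
  simp [Equiv.symm_apply_eq, he₁, he₂]

theorem Cocycle.card_transfer_of_free {C : Type*} [Group C] [MulAction Q X]
    (hfree : ∀ x, pointStabilizer (MulAction.toPermHom Q X) x = ⊥) (c c' : Cocycle C Q X) :
    Nat.card {b : X → C // ∀ q x, b x * c' q x = c q x * b (q⁻¹ • x)} =
      Nat.card C ^ (Nat.card X / Nat.card Q) := by
  obtain ⟨e, he⟩ := exists_equiv_prod_of_free _ hfree
  have he_smul (q : Q) (x : X) : e (q • x) = ((e x).1, q * (e x).2) := he q x
  have he_symm (x : X) : (e x).2⁻¹ • x = e.symm ((e x).1, 1) := by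
    rw [Equiv.eq_symm_apply, he_smul, inv_mul_cancel]
  have hmul (c : Cocycle C Q X) (q : Q) (x : X) :
      c q x * c (q⁻¹ * (e x).2) (q⁻¹ • x) = c (e x).2 x := by
    rw [← c.map_mul, mul_inv_cancel_left]
  have hfun : Nat.card C ^ (Nat.card X / Nat.card Q) =
      Nat.card (Fin (Nat.card X / Nat.card Q) → C) := by rw [Nat.card_fun, Nat.card_fin]
  rw [hfun]
  refine Nat.card_congr
    { toFun := fun b i => b.1 (e.symm (i, 1))
      invFun := fun a => ⟨fun x => c (e x).2 x * a (e x).1 * (c' (e x).2 x)⁻¹, fun q x => ?_⟩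
      left_inv := fun b => Subtype.ext <| funext fun x => ?_
      right_inv := fun a => funext fun i => ?_ }
  · beta_reduce
    rw [he_smul, ← hmul c q x, ← hmul c' q x]
    simp [mul_assoc]
  · change c (e x).2 x * b.1 (e.symm ((e x).1, 1)) * (c' (e x).2 x)⁻¹ = b.1 x
    rw [← he_symm, ← b.2, mul_inv_cancel_right]
  · simp [c.map_one, c'.map_one]

end FreeAction

section Intertwiner

/-- The elements over `τ` that intertwine two homomorphisms. -/
abbrev Intertwiner {W P Q : Type*} [Group W] [Group P] [Group Q] (p : W →* P) (τ : P)
    (f₁ f₂ : Q →* W) : Type _ :=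
  {t : W // p t = τ ∧ ∀ q, t * f₂ q = f₁ q * t}

theorem card_intertwiner_of_free {C Q X : Type*} [Group C] [Group Q] [Finite Q] [Finite X]
    {ρ₁ ρ₂ : Q →* Equiv.Perm X} (hfree : ∀ x, pointStabilizer ρ₁ x = ⊥) {τ : Equiv.Perm X}
    (hτ : ∀ q, τ * ρ₂ q = ρ₁ q * τ) (f₁ : HomLift (PermWreath.proj C X) ρ₁)
    (f₂ : HomLift (PermWreath.proj C X) ρ₂) :
    Nat.card (Intertwiner (PermWreath.proj C X) τ f₁.1 f₂.1) =
      Nat.card C ^ (Nat.card X / Nat.card Q) := by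
  obtain ⟨_, rfl⟩ := exists_mulAction_eq_toPermHom ρ₁
  have hright₁ (q) : (f₁.1 q).right = MulAction.toPermHom Q X q := DFunLike.congr_fun f₁.2 q
  have hright₂ (q) : (f₂.1 q).right = ρ₂ q := DFunLike.congr_fun f₂.2 q
  have hinv (q : Q) (x : X) : (ρ₂ q)⁻¹ (τ⁻¹ x) = τ⁻¹ (q⁻¹ • x) := by
    simpa using DFunLike.congr_fun (congrArg (·⁻¹) (hτ q)) x
  let c' : Cocycle C Q X :=
    { toFun := fun q x => (f₂.1 q).left (τ⁻¹ x)
      map_mul := fun g h x => by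
        rw [map_mul, SemidirectProduct.mul_left, hright₂, ← hinv]
        rfl }
  rw [← Cocycle.card_transfer_of_free hfree (homLiftEquivCocycle C Q X f₁) c']
  refine Nat.card_congr
    { toFun := fun t => ⟨t.1.left, fun q x => ?_⟩
      invFun := fun b => ⟨⟨b.1, τ⟩, rfl, fun q => ?_⟩
      left_inv := fun t => Subtype.ext (SemidirectProduct.ext rfl t.2.1.symm)
      right_inv := fun b => rfl }
  · have h := congrFun (congrArg SemidirectProduct.left (t.2.2 q)) x
    have hright : t.1.right = τ := t.2.1
    rw [SemidirectProduct.mul_left, SemidirectProduct.mul_left, hright, hright₁] at h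
    exact h
  · refine SemidirectProduct.ext (funext fun x => ?_) ?_
    · rw [SemidirectProduct.mul_left, SemidirectProduct.mul_left, hright₁]
      exact b.2 q x
    · rw [SemidirectProduct.mul_right, SemidirectProduct.mul_right, hright₁, hright₂]
      exact hτ q

end Intertwiner

namespace GraphOfGroups

variable {V : Type uV} {E : Type uE} (𝒢 : GraphOfGroups.{uV, uE, uG, uF} V E)

section Tree

variable {𝒢}

theorem Joined.mono {S T : Set E} (h : S ⊆ T) {u v : V} (huv : 𝒢.Joined S u v) :
    𝒢.Joined T u v :=
  Relation.EqvGen.mono (fun _ _ ⟨e, he, h'⟩ => ⟨e, h he, h'⟩) _ _ huv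

theorem exists_potential {A : Type*} [Group A] (T : Set E) (hT : T.Finite)
    (hacyc : ∀ e ∈ T, ¬ 𝒢.Joined (T \ {e}) (𝒢.src e) (𝒢.tgt e)) (a : E → A) :
    ∃ g : V → A, ∀ e ∈ T, g (𝒢.src e) * (g (𝒢.tgt e))⁻¹ = a e := by
  classical
  induction T, hT using Set.Finite.induction_on with
  | empty => exact ⟨fun _ => 1, by simp⟩
  | @insert e S heS _ ih =>
    obtain ⟨g, hg⟩ := ih fun e' he' h => hacyc e' (Set.mem_insert_of_mem _ he')
      (h.mono (Set.sdiff_subset_sdiff_left (Set.subset_insert _ _)))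
    have hse : ¬ 𝒢.Joined S (𝒢.src e) (𝒢.tgt e) := by
      have := hacyc e (Set.mem_insert _ _)
      rwa [Set.insert_sdiff_self_of_notMem heS] at this
    -- `e` joins two components of `S`; translating `g` on one of them adjusts it on `e` alone.
    refine ⟨fun v => if 𝒢.Joined S v (𝒢.tgt e) then
      g v * ((g (𝒢.tgt e))⁻¹ * (a e)⁻¹ * g (𝒢.src e)) else g v, ?_⟩
    rintro e' (rfl | he')
    · have : 𝒢.Joined S (𝒢.tgt e') (𝒢.tgt e') := Relation.EqvGen.refl _
      simp only [if_neg hse, if_pos this]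
      group
    · have hj : 𝒢.Joined S (𝒢.src e') (𝒢.tgt e') := Relation.EqvGen.rel _ _ ⟨e', he', rfl, rfl⟩
      have hiff : 𝒢.Joined S (𝒢.src e') (𝒢.tgt e) ↔ 𝒢.Joined S (𝒢.tgt e') (𝒢.tgt e) :=
        ⟨fun h => (hj.symm _ _).trans _ _ _ h, fun h => hj.trans _ _ _ h⟩
      by_cases h : 𝒢.Joined S (𝒢.tgt e') (𝒢.tgt e)
      · simp only [if_pos h, if_pos (hiff.2 h), ← hg e' he']
        group
      · simp only [if_neg h, if_neg (mt hiff.1 h), ← hg e' he']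

end Tree

section HomSystem

/-- A homomorphism from every vertex group and an element of `W` for every edge, subject to the
relations of the fundamental group, but without the condition on the edges of a maximal tree. -/
@[ext]
structure HomSystem (W : Type*) [Group W] where
  /-- the homomorphisms on the vertex groups -/
  vertex : ∀ v, 𝒢.vertexGroup v →* W
  /-- the images of the edge letters -/
  edge : E → W
  edge_mul : ∀ e a, edge e * vertex _ (𝒢.tgtHom e a) = vertex _ (𝒢.srcHom e a) * edge e

variable {𝒢} {W P : Type*} [Group W] [Group P]

namespace HomSystem

/-- The composition of a system with a homomorphism. -/
def map (p : W →* P) (s : 𝒢.HomSystem W) : 𝒢.HomSystem P where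
  vertex v := p.comp (s.vertex v)
  edge e := p (s.edge e)
  edge_mul e a := by simpa using congrArg p (s.edge_mul e a)

/-- Functions on the vertices act on systems by changing the coordinates at every vertex (gauge
transformations). -/
instance : MulAction (V → W) (𝒢.HomSystem W) where
  smul g s :=
    { vertex := fun v => (MulAut.conj (g v)).toMonoidHom.comp (s.vertex v)
      edge := fun e => g (𝒢.src e) * s.edge e * (g (𝒢.tgt e))⁻¹
      edge_mul := fun e a => by
        have := congrArg (fun w => g (𝒢.src e) * w * (g (𝒢.tgt e))⁻¹) (s.edge_mul e a)
        simpa [mul_assoc] using this }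
  one_smul s := HomSystem.ext (by ext; simp [HSMul.hSMul]) (by simp [HSMul.hSMul])
  mul_smul g h s :=
    HomSystem.ext (by ext; simp [HSMul.hSMul]) (by ext; simp [HSMul.hSMul, mul_assoc])

theorem smul_vertex (g : V → W) (s : 𝒢.HomSystem W) (v : V) (x : 𝒢.vertexGroup v) :
    (g • s).vertex v x = g v * s.vertex v x * (g v)⁻¹ :=
  rfl

theorem smul_edge (g : V → W) (s : 𝒢.HomSystem W) (e : E) :
    (g • s).edge e = g (𝒢.src e) * s.edge e * (g (𝒢.tgt e))⁻¹ :=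
  rfl

protected theorem map_smul (p : W →* P) (g : V → W) (s : 𝒢.HomSystem W) :
    (g • s).map p = (p ∘ g) • s.map p :=
  HomSystem.ext (by ext; simp [map, smul_vertex]) (by ext; simp [map, smul_edge])

end HomSystem

end HomSystem

end GraphOfGroups

namespace GraphOfGroups

variable {V : Type uV} {E : Type uE} (𝒢 : GraphOfGroups.{uV, uE, uG, uF} V E) (T : Set E)

section FundGroup

/-- The canonical homomorphism from a vertex group to the fundamental group. -/
def vertexHom (v : V) : 𝒢.vertexGroup v →* 𝒢.FundGroup T :=
  (QuotientGroup.mk' (Subgroup.normalClosure (𝒢.relators T))).comp (𝒢.ofVertex v)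

/-- The element of the fundamental group given by an edge. -/
def stableLetter (e : E) : 𝒢.FundGroup T :=
  QuotientGroup.mk' (Subgroup.normalClosure (𝒢.relators T)) (𝒢.letter e)

theorem stableLetter_eq_one {e : E} (he : e ∈ T) : 𝒢.stableLetter T e = 1 :=
  (QuotientGroup.eq_one_iff _).2 (Subgroup.subset_normalClosure (Or.inr ⟨e, he, rfl⟩))

theorem stableLetter_mul_vertexHom (e : E) (a : 𝒢.edgeGroup e) :
    𝒢.stableLetter T e * 𝒢.vertexHom T _ (𝒢.tgtHom e a) =
      𝒢.vertexHom T _ (𝒢.srcHom e a) * 𝒢.stableLetter T e := by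
  have h : QuotientGroup.mk' (Subgroup.normalClosure (𝒢.relators T))
      (𝒢.letter e * 𝒢.ofVertex (𝒢.tgt e) (𝒢.tgtHom e a) * (𝒢.letter e)⁻¹ *
        (𝒢.ofVertex (𝒢.src e) (𝒢.srcHom e a))⁻¹) = 1 :=
    (QuotientGroup.eq_one_iff _).2 (Subgroup.subset_normalClosure (Or.inl ⟨e, a, rfl⟩))
  rwa [map_mul, map_mul, map_mul, map_inv, map_inv, mul_inv_eq_one, mul_inv_eq_iff_eq_mul] at h

variable {𝒢 T} {W P : Type*} [Group W] [Group P]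

namespace HomSystem

/-- The restriction of a homomorphism on the fundamental group to the vertex groups and the stable
letters. -/
def ofHom (f : 𝒢.FundGroup T →* W) : 𝒢.HomSystem W where
  vertex v := f.comp (𝒢.vertexHom T v)
  edge e := f (𝒢.stableLetter T e)
  edge_mul e a := by simpa using congrArg f (𝒢.stableLetter_mul_vertexHom T e a)

theorem ofHom_comp (p : W →* P) (f : 𝒢.FundGroup T →* W) : ofHom (p.comp f) = (ofHom f).map p :=
  rfl

theorem ofHom_injective : Function.Injective (ofHom : (𝒢.FundGroup T →* W) → 𝒢.HomSystem W) :=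
  fun _ _ h => QuotientGroup.monoidHom_ext _ <| Monoid.Coprod.hom_ext
    (Monoid.CoprodI.ext_hom _ _ fun v => congrFun (congrArg vertex h) v)
    (FreeGroup.ext_hom _ _ fun e => congrFun (congrArg edge h) e)

theorem exists_ofHom_eq (s : 𝒢.HomSystem W) (hs : ∀ e ∈ T, s.edge e = 1) :
    ∃ f : 𝒢.FundGroup T →* W, ofHom f = s := by
  let f₀ : 𝒢.BigFreeProduct →* W :=
    Monoid.Coprod.lift (Monoid.CoprodI.lift s.vertex) (FreeGroup.lift s.edge)
  have hvertex (v x) : f₀ (𝒢.ofVertex v x) = s.vertex v x := by simp [f₀, ofVertex]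
  have hedge (e) : f₀ (𝒢.letter e) = s.edge e := by simp [f₀, letter]
  have hker : Subgroup.normalClosure (𝒢.relators T) ≤ f₀.ker := by
    refine Subgroup.normalClosure_le_normal ?_
    rintro x (⟨e, a, rfl⟩ | ⟨e, he, rfl⟩)
    · simp [MonoidHom.mem_ker, hvertex, hedge, s.edge_mul]
    · simp [MonoidHom.mem_ker, hedge, hs e he]
  exact ⟨QuotientGroup.lift _ f₀ hker,
    HomSystem.ext (funext fun v => MonoidHom.ext (hvertex v)) (funext hedge)⟩

theorem gauge_eq_of_smul_ofHom_eq (hT : 𝒢.IsMaximalTree T) {f f' : 𝒢.FundGroup T →* W}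
    {g g' : V → W} (h : g • ofHom f = g' • ofHom f') {v₀ : V} (h₀ : g v₀ = g' v₀) : g = g' := by
  have hconst (u v) (huv : 𝒢.Joined T u v) : (g' u)⁻¹ * g u = (g' v)⁻¹ * g v := by
    induction huv with
    | rel u v huv =>
      obtain ⟨e, he, rfl, rfl⟩ := huv
      have hedge := congrFun (congrArg edge h) e
      simp only [smul_edge, ofHom, stableLetter_eq_one 𝒢 T he, map_one, mul_one] at hedge
      rw [inv_mul_eq_iff_eq_mul, ← mul_assoc, ← hedge, inv_mul_cancel_right]
    | refl => rfl
    | symm _ _ _ ih => exact ih.symm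
    | trans _ _ _ _ _ ih ih' => exact ih.trans ih'
  funext v
  have hv := hconst v v₀ (hT.connected v v₀)
  rw [h₀, inv_mul_cancel, inv_mul_eq_one] at hv
  exact hv.symm

theorem exists_smul_ofHom_eq [Finite E] (hT : 𝒢.IsMaximalTree T) (s : 𝒢.HomSystem W) (v₀ : V)
    (w : W) : ∃ (f : 𝒢.FundGroup T →* W) (g : V → W), g • ofHom f = s ∧ g v₀ = w := by
  obtain ⟨a, ha⟩ := exists_potential T T.toFinite hT.acyclic s.edge
  let g (v : V) : W := a v * (a v₀)⁻¹ * w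
  have hg (e) (he : e ∈ T) : (g⁻¹ • s).edge e = 1 := by
    simp [smul_edge, g, ← ha e he, mul_assoc]
  obtain ⟨f, hf⟩ := exists_ofHom_eq _ hg
  exact ⟨f, g, by rw [hf, smul_inv_smul], by simp [g]⟩

/-- A gauge transformation with a prescribed value at `v₀` makes the edges of the maximal tree act
trivially, in a unique way. -/
theorem bijective_smul_ofHom [Finite E] (hT : 𝒢.IsMaximalTree T) (v₀ : V) :
    Function.Bijective fun q : (𝒢.FundGroup T →* W) × (V → W) => (q.2 • ofHom q.1, q.2 v₀) := by
  refine ⟨fun ⟨f, g⟩ ⟨f', g'⟩ h => ?_, fun ⟨s, w⟩ => ?_⟩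
  · obtain ⟨hs, hw⟩ := Prod.ext_iff.1 h
    obtain rfl : g = g' := gauge_eq_of_smul_ofHom_eq hT hs hw
    exact Prod.ext (ofHom_injective (smul_left_cancel _ hs)) rfl
  · obtain ⟨f, g, hs, hw⟩ := exists_smul_ofHom_eq hT s v₀ w
    exact ⟨(f, g), Prod.ext hs hw⟩

end HomSystem

end FundGroup

section LiftSystem

variable {𝒢 T} {W P : Type*} [Group W] [Group P]

open HomSystem

/-- The lifts of a system along a homomorphism. -/
abbrev LiftSystem (p : W →* P) (r : 𝒢.HomSystem P) : Type _ :=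
  {s : 𝒢.HomSystem W // s.map p = r}

/-- A lift of a system consists of lifts on the vertex groups and of intertwiners of their
restrictions to the edge groups. -/
def liftSystemEquiv (p : W →* P) (r : 𝒢.HomSystem P) :
    LiftSystem p r ≃ Σ σ : ∀ v, HomLift p (r.vertex v), ∀ e,
      Intertwiner p (r.edge e) ((σ (𝒢.src e)).1.comp (𝒢.srcHom e))
        ((σ (𝒢.tgt e)).1.comp (𝒢.tgtHom e)) where
  toFun s := ⟨fun v => ⟨s.1.vertex v, congrFun (congrArg vertex s.2) v⟩,
    fun e => ⟨s.1.edge e, congrFun (congrArg edge s.2) e, s.1.edge_mul e⟩⟩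
  invFun d := ⟨⟨fun v => (d.1 v).1, fun e => (d.2 e).1, fun e => (d.2 e).2.2⟩,
    HomSystem.ext (funext fun v => (d.1 v).2) (funext fun e => (d.2 e).2.1)⟩
  left_inv _ := rfl
  right_inv _ := rfl

theorem nonempty_homLift_prod_equiv [Finite E] (hT : 𝒢.IsMaximalTree T) (v₀ : V) (p : W →* P)
    (β : 𝒢.FundGroup T →* P) :
    Nonempty (HomLift p β × (V → p.ker) ≃ LiftSystem p (ofHom β) × p.ker) := by
  have hmap (f : HomLift p β) (g : V → p.ker) :
      ((fun v => (g v : W)) • ofHom f.1).map p = ofHom β := by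
    have hg : (p ∘ fun v => (g v : W)) = 1 := funext fun v => (g v).2
    rw [HomSystem.map_smul, ← ofHom_comp, f.2, hg, one_smul]
  refine ⟨.ofBijective (fun q => (⟨(fun v => (q.2 v : W)) • ofHom q.1.1, hmap q.1 q.2⟩, q.2 v₀))
    ⟨fun ⟨f, g⟩ ⟨f', g'⟩ h => ?_, fun ⟨⟨s, hs⟩, k⟩ => ?_⟩⟩
  · obtain ⟨hs, hk⟩ := Prod.ext_iff.1 h
    have hinj := (bijective_smul_ofHom hT v₀).injective
      (a₁ := (f.1, fun v => (g v : W))) (a₂ := (f'.1, fun v => (g' v : W)))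
      (Prod.ext (congrArg Subtype.val hs) (congrArg Subtype.val hk))
    obtain ⟨hf, hg⟩ := Prod.ext_iff.1 hinj
    exact Prod.ext (Subtype.ext hf) (funext fun v => Subtype.ext (congrFun hg v))
  · obtain ⟨f, g, rfl, hk⟩ := exists_smul_ofHom_eq hT s v₀ (k : W)
    -- Uniqueness in `P` shows that `f` lifts `β` and that `g` takes its values in the kernel.
    have hinj := (bijective_smul_ofHom hT v₀).injective
      (a₁ := (p.comp f, p ∘ g)) (a₂ := (β, 1)) (Prod.ext
        (by simpa only [ofHom_comp, HomSystem.map_smul, one_smul] using hs)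
        ((congrArg p hk).trans k.2))
    obtain ⟨hf, hg⟩ := Prod.ext_iff.1 hinj
    exact ⟨(⟨f, hf⟩, fun v => ⟨g v, congrFun hg v⟩), Prod.ext rfl (Subtype.ext hk)⟩

end LiftSystem

end GraphOfGroups

namespace GraphOfGroups

variable {V : Type uV} {E : Type uE} {𝒢 : GraphOfGroups.{uV, uE, uG, uF} V E} {T : Set E}

section Additivity

open HomSystem

theorem fg_fundGroup [Finite V] [Finite E] [∀ v, Group.FG (𝒢.vertexGroup v)] :
    Group.FG (𝒢.FundGroup T) := by
  let K : Subgroup (𝒢.FundGroup T) :=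
    (⨆ v, (𝒢.vertexHom T v).range) ⊔ Subgroup.closure (Set.range (𝒢.stableLetter T))
  have hvertex (v) (a : 𝒢.vertexGroup v) : 𝒢.vertexHom T v a ∈ K :=
    Subgroup.mem_sup_left (Subgroup.mem_iSup_of_mem v ⟨a, rfl⟩)
  have hedge (e) : 𝒢.stableLetter T e ∈ K :=
    Subgroup.mem_sup_right (Subgroup.subset_closure ⟨e, rfl⟩)
  obtain ⟨f, hf⟩ := exists_ofHom_eq (T := T)
    { vertex := fun v => (𝒢.vertexHom T v).codRestrict K (hvertex v)
      edge := fun e => ⟨𝒢.stableLetter T e, hedge e⟩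
      edge_mul := fun e a => Subtype.ext (𝒢.stableLetter_mul_vertexHom T e a) :
        𝒢.HomSystem K }
    fun e he => Subtype.ext (𝒢.stableLetter_eq_one T he)
  have hid : K.subtype.comp f = .id _ := ofHom_injective (by rw [ofHom_comp, hf]; rfl)
  have htop : K = ⊤ := eq_top_iff.2 fun x _ => by
    rw [← show (f x : 𝒢.FundGroup T) = x from DFunLike.congr_fun hid x]
    exact (f x).2
  have hrange (v) : (𝒢.vertexHom T v).range.FG := by
    rw [← Group.fg_iff_subgroup_fg]
    infer_instance
  have hK : K.FG := (Subgroup.FG.iSup _ hrange).sup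
    ((Subgroup.fg_iff _).2 ⟨_, rfl, Set.finite_range _⟩)
  exact ⟨htop ▸ hK⟩

/-- All the edge groups act freely. This is asked for the inclusions at the initial vertices only,
since `r.edge e` conjugates the two actions of the group of `e`. -/
def EdgeFree {X : Type*} (r : 𝒢.HomSystem (Equiv.Perm X)) : Prop :=
  ∀ e x, pointStabilizer ((r.vertex _).comp (𝒢.srcHom e)) x = ⊥

variable [Fintype V] [Fintype E] [∀ v, Group.FG (𝒢.vertexGroup v)] [∀ e, Finite (𝒢.edgeGroup e)]
  {C X : Type*} [Group C] [Finite C]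

theorem card_liftSystem_of_edgeFree [Finite X] {r : 𝒢.HomSystem (Equiv.Perm X)}
    (hr : EdgeFree r) :
    Nat.card (LiftSystem (PermWreath.proj C X) r) =
      (∏ v, Nat.card (HomLift (PermWreath.proj C X) (r.vertex v))) *
        ∏ e, Nat.card C ^ (Nat.card X / Nat.card (𝒢.edgeGroup e)) := by
  have hfiber (σ : ∀ v, HomLift (PermWreath.proj C X) (r.vertex v)) :
      Nat.card (∀ e, Intertwiner (PermWreath.proj C X) (r.edge e)
        ((σ (𝒢.src e)).1.comp (𝒢.srcHom e)) ((σ (𝒢.tgt e)).1.comp (𝒢.tgtHom e))) =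
      ∏ e, Nat.card C ^ (Nat.card X / Nat.card (𝒢.edgeGroup e)) := by
    rw [Nat.card_pi]
    have hcomp {v} {Q : Type uF} [Group Q] (f : Q →* 𝒢.vertexGroup v) :
        (PermWreath.proj C X).comp ((σ v).1.comp f) = (r.vertex v).comp f := by
      rw [← MonoidHom.comp_assoc, (σ v).2]
    exact Finset.prod_congr rfl fun e _ =>
      card_intertwiner_of_free (ρ₂ := (r.vertex _).comp (𝒢.tgtHom e)) (hr e) (r.edge_mul e)
        ⟨_, hcomp (𝒢.srcHom e)⟩ ⟨_, hcomp (𝒢.tgtHom e)⟩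
  have := Fintype.ofFinite (∀ v, HomLift (PermWreath.proj C X) (r.vertex v))
  rw [Nat.card_congr (liftSystemEquiv _ r), Nat.card_sigma,
    Finset.sum_congr rfl fun σ _ => hfiber σ, Finset.sum_const, Finset.card_univ,
    ← Nat.card_eq_fintype_card, Nat.card_pi, smul_eq_mul]

theorem card_homLift_fundGroup [Finite X] (hT : 𝒢.IsMaximalTree T)
    {ρ : 𝒢.FundGroup T →* Equiv.Perm X} (hρ : EdgeFree (ofHom ρ)) :
    Nat.card (HomLift (PermWreath.proj C X) ρ) * (Nat.card C ^ Nat.card X) ^ Fintype.card V =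
      (∏ v, Nat.card (HomLift (PermWreath.proj C X) (ρ.comp (𝒢.vertexHom T v)))) *
        (∏ e, Nat.card C ^ (Nat.card X / Nat.card (𝒢.edgeGroup e))) * Nat.card C ^ Nat.card X := by
  obtain ⟨v₀⟩ := hT.nonempty
  obtain ⟨φ⟩ := nonempty_homLift_prod_equiv hT v₀ (PermWreath.proj C X) ρ
  have hcard := Nat.card_congr φ
  rwa [Nat.card_prod, Nat.card_prod, Nat.card_fun, Nat.card_eq_fintype_card (α := V),
    PermWreath.card_ker_proj, card_liftSystem_of_edgeFree hρ] at hcard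

theorem sum_homDensity_fundGroup [Nontrivial C] [Fintype X] (hT : 𝒢.IsMaximalTree T)
    {ρ : 𝒢.FundGroup T →* Equiv.Perm X} (hρ : EdgeFree (ofHom ρ)) :
    ∑ x, homDensity C (pointStabilizer ρ x) =
      ∑ v, ∑ x, homDensity C (pointStabilizer (ρ.comp (𝒢.vertexHom T v)) x) +
        Fintype.card X * ∑ e, (1 : ℝ) / Nat.card (𝒢.edgeGroup e) := by
  have := fg_fundGroup (𝒢 := 𝒢) (T := T)
  have hC := one_lt_natCast_card C
  have hlift : (Nat.card (HomLift (PermWreath.proj C X) ρ) : ℝ) ≠ 0 := by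
    exact_mod_cast (card_homLift_pos ρ).ne'
  have hvertex (v) :
      (Nat.card (HomLift (PermWreath.proj C X) (ρ.comp (𝒢.vertexHom T v))) : ℝ) ≠ 0 := by
    exact_mod_cast (card_homLift_pos (ρ.comp (𝒢.vertexHom T v))).ne'
  have hdiv (e) : ((Fintype.card X / Nat.card (𝒢.edgeGroup e) : ℕ) : ℝ) =
      Fintype.card X * (1 / Nat.card (𝒢.edgeGroup e)) := by
    have hdvd := card_dvd_card_of_free _ (hρ e)
    rw [Nat.card_eq_fintype_card (α := X)] at hdvd
    rw [Nat.cast_div hdvd (by exact_mod_cast Nat.card_pos.ne'), mul_one_div]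
  have hlogb := congrArg (fun n : ℕ => Real.logb (Nat.card C) n)
    (card_homLift_fundGroup (C := C) hT hρ)
  push_cast at hlogb
  rw [Real.logb_mul hlift (by positivity), Real.logb_mul (mul_ne_zero
    (Finset.prod_ne_zero_iff.2 fun v _ => hvertex v) (by positivity)) (by positivity),
    Real.logb_mul (Finset.prod_ne_zero_iff.2 fun v _ => hvertex v) (by positivity),
    Real.logb_prod _ _ fun v _ => hvertex v, Real.logb_prod _ _ fun e _ => by positivity] at hlogb
  simp only [Real.logb_pow, Real.logb_self_eq_one hC, mul_one, logb_card_homLift, hdiv,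
    ← Finset.mul_sum, Nat.card_eq_fintype_card (α := X), Finset.sum_add_distrib, Finset.sum_const,
    Finset.card_univ, nsmul_eq_mul] at hlogb
  linarith

end Additivity

end GraphOfGroups

section ProductOfCosetSpaces

variable {ι : Type*} [DecidableEq ι] {G : ι → Type*} [∀ i, Group (G i)] (K : ∀ i, Subgroup (G i))

/-- The action of a factor on its own coordinate in a product of coset spaces. -/
def coordinatePerm (i : ι) : G i →* Equiv.Perm (∀ j, G j ⧸ K j) :=
  (MulAction.toPermHom (∀ j, G j) (∀ j, G j ⧸ K j)).comp (MonoidHom.mulSingle G i)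

theorem pointStabilizer_coordinatePerm (i : ι) (x : ∀ j, G j ⧸ K j) :
    pointStabilizer (coordinatePerm K i) x = MulAction.stabilizer (G i) (x i) := by
  ext g
  change Pi.mulSingle i g • x = x ↔ g • x i = x i
  refine ⟨fun h => by simpa using congrFun h i, fun h => funext fun j => ?_⟩
  obtain rfl | hj := eq_or_ne j i
  · simpa using h
  · simp [Pi.mulSingle_eq_of_ne hj]

end ProductOfCosetSpaces

section Conjugate

variable {G H X : Type*} [Group G] [Group H]

theorem conj_smul_le_of_le {K N : Subgroup G} [N.Normal] (h : K ≤ N) (g : G) :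
    MulAut.conj g • K ≤ N :=
  (Subgroup.pointwise_smul_le_pointwise_smul_iff.2 h).trans_eq
    (Subgroup.Normal.conj_smul_eq_self g N)

theorem pointStabilizer_conj_comp (ρ : G →* Equiv.Perm X) (τ : Equiv.Perm X) (x : X) :
    pointStabilizer ((MulAut.conj τ).toMonoidHom.comp ρ) x = pointStabilizer ρ (τ⁻¹ x) := by
  ext g
  simp [← Equiv.Perm.eq_inv_iff_eq (f := τ)]

theorem pointStabilizer_comp_eq_bot {ρ : G →* Equiv.Perm X} {N : Subgroup G} {x : X}
    (h : pointStabilizer ρ x ≤ N) {f : H →* G} (hN : N.comap f = ⊥) :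
    pointStabilizer (ρ.comp f) x = ⊥ :=
  eq_bot_iff.2 ((Subgroup.comap_mono h).trans_eq hN)

end Conjugate

theorem exists_finiteIndex_inter_trivial {G : Type*} [Group G]
    (hG : Group.ResiduallyFinite G ∨ IsVirtuallyTorsionFree G) {S : Set G} (hS : S.Finite)
    (hord : ∀ g ∈ S, IsOfFinOrder g) :
    ∃ N : Subgroup G, N.FiniteIndex ∧ ∀ g ∈ S, g ∈ N → g = 1 := by
  rcases hG with hG | ⟨H, hH, h⟩
  · have hsep (g : G) : ∃ N : Subgroup G, N.FiniteIndex ∧ (g ∈ N → g = 1) := by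
      obtain rfl | hg := eq_or_ne g 1
      · exact ⟨⊤, inferInstance, fun _ => rfl⟩
      · obtain ⟨N, hN⟩ := Group.exists_finiteIndexNormalSubgroup_notMem g hg
        exact ⟨N.toSubgroup, inferInstance, fun h => absurd h hN⟩
    choose N hN hgN using hsep
    have := hS.to_subtype
    exact ⟨⨅ g : S, N g, Subgroup.finiteIndex_iInf fun g => hN g,
      fun g hg hmem => hgN g (Subgroup.mem_iInf.1 hmem ⟨g, hg⟩)⟩
  · exact ⟨H, hH, fun g hg hgH => h g hgH (hord g hg)⟩

namespace GraphOfGroups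

variable {V : Type uV} {E : Type uE} {𝒢 : GraphOfGroups.{uV, uE, uG, uF} V E} {T : Set E}

open HomSystem

section Separation

variable (𝒢) in
/-- The edge groups meet the given subgroups of the vertex groups trivially. -/
def SeparatesEdges (N : ∀ v, Subgroup (𝒢.vertexGroup v)) : Prop :=
  (∀ e, (N (𝒢.src e)).comap (𝒢.srcHom e) = ⊥) ∧ ∀ e, (N (𝒢.tgt e)).comap (𝒢.tgtHom e) = ⊥

theorem SeparatesEdges.mono {N N' : ∀ v, Subgroup (𝒢.vertexGroup v)} (hN : 𝒢.SeparatesEdges N)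
    (h : ∀ v, N' v ≤ N v) : 𝒢.SeparatesEdges N' :=
  ⟨fun e => eq_bot_iff.2 ((Subgroup.comap_mono (h _)).trans_eq (hN.1 e)),
    fun e => eq_bot_iff.2 ((Subgroup.comap_mono (h _)).trans_eq (hN.2 e))⟩

theorem SeparatesEdges.edgeFree {N : ∀ v, Subgroup (𝒢.vertexGroup v)} (hN : 𝒢.SeparatesEdges N)
    {X : Type*} {r : 𝒢.HomSystem (Equiv.Perm X)} (h : ∀ v x, pointStabilizer (r.vertex v) x ≤ N v) :
    EdgeFree r :=
  fun e x => pointStabilizer_comp_eq_bot (h _ x) (hN.1 e)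

theorem SeparatesEdges.finite_edgeGroup {N : ∀ v, Subgroup (𝒢.vertexGroup v)}
    [∀ v, (N v).FiniteIndex] (hN : 𝒢.SeparatesEdges N) (e : E) : Finite (𝒢.edgeGroup e) := by
  refine Nat.finite_of_card_ne_zero ?_
  rw [← Subgroup.index_bot, ← hN.1 e]
  exact Subgroup.index_ne_zero_of_finite

variable (𝒢) in
/-- The vertex groups have finite index normal subgroups that meet the edge groups trivially. -/
def IsEdgeSeparated : Prop :=
  ∃ N : ∀ v, Subgroup (𝒢.vertexGroup v),
    (∀ v, (N v).Normal) ∧ (∀ v, (N v).FiniteIndex) ∧ 𝒢.SeparatesEdges N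

theorem isEdgeSeparated_of_residuallyFinite_or_virtuallyTorsionFree [Finite E]
    [∀ e, Finite (𝒢.edgeGroup e)]
    (hvertex : ∀ v, Group.ResiduallyFinite (𝒢.vertexGroup v) ∨
      IsVirtuallyTorsionFree (𝒢.vertexGroup v)) : 𝒢.IsEdgeSeparated := by
  let R : Set (Σ v, 𝒢.vertexGroup v) :=
    Set.range (fun z : Σ e, 𝒢.edgeGroup e => ⟨_, 𝒢.srcHom z.1 z.2⟩) ∪
      Set.range (fun z : Σ e, 𝒢.edgeGroup e => ⟨_, 𝒢.tgtHom z.1 z.2⟩)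
  have hR : R.Finite := (Set.finite_range _).union (Set.finite_range _)
  have hord : ∀ z ∈ R, IsOfFinOrder z.2 := by
    rintro _ (⟨z, rfl⟩ | ⟨z, rfl⟩)
    · exact (𝒢.srcHom z.1).isOfFinOrder (isOfFinOrder_of_finite z.2)
    · exact (𝒢.tgtHom z.1).isOfFinOrder (isOfFinOrder_of_finite z.2)
  choose N hN hNR using fun v => exists_finiteIndex_inter_trivial (hvertex v)
    (S := Sigma.mk v ⁻¹' R) (hR.preimage sigma_mk_injective.injOn) fun g hg => hord _ hg
  refine ⟨fun v => (N v).normalCore, fun v => inferInstance, fun v => inferInstance,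
    fun e => (Subgroup.eq_bot_iff_forall _).2 fun a ha => ?_,
    fun e => (Subgroup.eq_bot_iff_forall _).2 fun a ha => ?_⟩
  · exact (map_eq_one_iff _ (𝒢.srcHom_injective e)).1
      (hNR _ _ (Or.inl ⟨⟨e, a⟩, rfl⟩) (Subgroup.normalCore_le _ ha))
  · exact (map_eq_one_iff _ (𝒢.tgtHom_injective e)).1
      (hNR _ _ (Or.inr ⟨⟨e, a⟩, rfl⟩) (Subgroup.normalCore_le _ ha))

end Separation

section PermutationRepresentation

variable [Finite V] [Finite E] {N K : ∀ v, Subgroup (𝒢.vertexGroup v)}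

theorem exists_perm_pointStabilizer_vertex (hT : 𝒢.IsMaximalTree T) (hsep : 𝒢.SeparatesEdges N)
    [∀ v, (N v).Normal] [∀ v, (K v).FiniteIndex] (hKN : ∀ v, K v ≤ N v) :
    ∃ (X : Type (max uV uG)) (_ : Finite X) (_ : Nonempty X) (ρ : 𝒢.FundGroup T →* Equiv.Perm X),
      ∀ v x, ∃ g : 𝒢.vertexGroup v,
        pointStabilizer (ρ.comp (𝒢.vertexHom T v)) x = MulAut.conj g • K v := by
  classical
  have hstab (v) (x : ∀ v, 𝒢.vertexGroup v ⧸ K v) :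
      ∃ g : 𝒢.vertexGroup v, pointStabilizer (coordinatePerm K v) x = MulAut.conj g • K v := by
    rw [pointStabilizer_coordinatePerm]
    exact exists_stabilizer_quotient_eq_conj_smul _
  have hle (v) (x : ∀ v, 𝒢.vertexGroup v ⧸ K v) : pointStabilizer (coordinatePerm K v) x ≤ N v := by
    obtain ⟨g, hg⟩ := hstab v x
    exact hg.trans_le (conj_smul_le_of_le (hKN v) g)
  have := fun v => Subgroup.finiteIndex_of_le (hKN v)
  have := hsep.finite_edgeGroup
  choose τ hτ using fun e => exists_perm_mul_eq_of_free
    (fun x => pointStabilizer_comp_eq_bot (hle _ x) (hsep.1 e))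
    (fun x => pointStabilizer_comp_eq_bot (hle _ x) (hsep.2 e))
  obtain ⟨v₀⟩ := hT.nonempty
  obtain ⟨ρ, g, hρ, -⟩ := exists_smul_ofHom_eq hT ⟨coordinatePerm K, τ, hτ⟩ v₀ 1
  refine ⟨_, inferInstance, inferInstance, ρ, fun v x => ?_⟩
  have hvertex : ρ.comp (𝒢.vertexHom T v) =
      (MulAut.conj (g v)⁻¹).toMonoidHom.comp (coordinatePerm K v) := by
    rw [← eq_inv_smul_iff] at hρ
    exact congrFun (congrArg vertex hρ) v
  rw [hvertex, pointStabilizer_conj_comp]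
  exact hstab v _

theorem IsEdgeSeparated.exists_normal_comap_le (hsep : 𝒢.IsEdgeSeparated) (hT : 𝒢.IsMaximalTree T)
    (H : ∀ v, Subgroup (𝒢.vertexGroup v)) [∀ v, (H v).FiniteIndex] :
    ∃ M : Subgroup (𝒢.FundGroup T), M.Normal ∧ M.FiniteIndex ∧
      (∀ v, M.comap (𝒢.vertexHom T v) ≤ H v) ∧
      𝒢.SeparatesEdges fun v => M.comap (𝒢.vertexHom T v) := by
  obtain ⟨N, _, _, hN⟩ := hsep
  obtain ⟨X, _, ⟨x⟩, ρ, hρ⟩ := exists_perm_pointStabilizer_vertex hT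
    (hN.mono fun v => inf_le_left (b := (H v).normalCore)) fun v => le_rfl
  have hker (v) : ρ.ker.comap (𝒢.vertexHom T v) ≤ N v ⊓ (H v).normalCore := by
    obtain ⟨g, hg⟩ := hρ v x
    rw [Subgroup.Normal.conj_smul_eq_self] at hg
    exact hg ▸ fun a (ha : ρ _ = 1) => DFunLike.congr_fun ha x
  exact ⟨ρ.ker, inferInstance, inferInstance,
    fun v => (hker v).trans (inf_le_right.trans (Subgroup.normalCore_le _)),
    hN.mono fun v => (hker v).trans inf_le_left⟩

theorem exists_perm_pointStabilizer (hT : 𝒢.IsMaximalTree T) (M : Subgroup (𝒢.FundGroup T))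
    [M.Normal] [M.FiniteIndex] (hM : 𝒢.SeparatesEdges fun v => M.comap (𝒢.vertexHom T v))
    [∀ v, (K v).FiniteIndex] (hKM : ∀ v, K v ≤ M.comap (𝒢.vertexHom T v)) :
    ∃ (X : Type (max uE uV uG)) (_ : Finite X) (_ : Nonempty X)
      (ρ : 𝒢.FundGroup T →* Equiv.Perm X), (∀ x, pointStabilizer ρ x ≤ M) ∧
      ∀ v x, ∃ g : 𝒢.vertexGroup v,
        pointStabilizer (ρ.comp (𝒢.vertexHom T v)) x = MulAut.conj g • K v := by
  obtain ⟨X, _, _, ρ, hρ⟩ := exists_perm_pointStabilizer_vertex hT hM hKM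
  obtain ⟨_, rfl⟩ := exists_mulAction_eq_toPermHom ρ
  have hquot (y : 𝒢.FundGroup T ⧸ M) : MulAction.stabilizer (𝒢.FundGroup T) y = M := by
    obtain ⟨g, hg⟩ := exists_stabilizer_quotient_eq_conj_smul y
    rw [hg, Subgroup.Normal.conj_smul_eq_self]
  have hstab (z : X × (𝒢.FundGroup T ⧸ M)) :
      pointStabilizer (MulAction.toPermHom (𝒢.FundGroup T) _) z =
        pointStabilizer (MulAction.toPermHom (𝒢.FundGroup T) _) z.1 ⊓ M := by
    ext γ
    have hγ : γ • z.2 = z.2 ↔ γ ∈ M := by rw [← MulAction.mem_stabilizer_iff, hquot]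
    exact Prod.ext_iff.trans (and_congr_right' hγ)
  refine ⟨X × (𝒢.FundGroup T ⧸ M), inferInstance, inferInstance, MulAction.toPermHom _ _,
    fun z => hstab z ▸ inf_le_right, fun v z => ?_⟩
  obtain ⟨g, hg⟩ := hρ v z.1
  refine ⟨g, ?_⟩
  rw [pointStabilizer_comp, hstab, Subgroup.comap_inf, ← pointStabilizer_comp, hg]
  exact inf_eq_left.2 (conj_smul_le_of_le (hKM v) g)

end PermutationRepresentation

end GraphOfGroups

section Volume

variable {C G : Type*} [Group C] [Group G]

theorem homVolume_eq_iInf_iSup_homDensity :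
    homVolume C G = ⨅ (H : Subgroup G) (_ : H.FiniteIndex),
      ⨆ (K : Subgroup G) (_ : K.FiniteIndex) (_ : K ≤ H), (homDensity C K : EReal) := by
  simp only [homVolume, homDensity, Real.logb, one_div_mul_eq_div]

variable (C G) in
theorem modifiedHomVolume_eq_homVolume : modifiedHomVolume C G = homVolume C G := by
  rw [modifiedHomVolume]
  split_ifs with hG
  · rw [homVolume_eq_iInf_iSup_homDensity, ← homDensity_bot C]
    refine le_antisymm
      (le_iInf₂ fun H _ => le_iSup_of_le ⊥ (le_iSup₂_of_le inferInstance bot_le le_rfl))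
      (iInf₂_le_of_le ⊥ inferInstance (iSup_le fun K => iSup₂_le fun _ hK => ?_))
    rw [le_bot_iff.1 hK]
  · rfl

theorem homVolume_le {r : ℝ} (H : Subgroup G) [hH : H.FiniteIndex]
    (h : ∀ K ≤ H, K.FiniteIndex → homDensity C K ≤ r) : homVolume C G ≤ r := by
  rw [homVolume_eq_iInf_iSup_homDensity]
  exact iInf₂_le_of_le H hH
    (iSup_le fun K => iSup₂_le fun hK hKH => EReal.coe_le_coe_iff.2 (h K hKH hK))

theorem le_homVolume {r : ℝ}
    (h : ∀ H : Subgroup G, H.FiniteIndex → ∃ K ≤ H, K.FiniteIndex ∧ r ≤ homDensity C K) :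
    r ≤ homVolume C G := by
  rw [homVolume_eq_iInf_iSup_homDensity]
  refine le_iInf₂ fun H hH => ?_
  obtain ⟨K, hKH, hK, hr⟩ := h H hH
  exact le_iSup_of_le K (le_iSup₂_of_le hK hKH (EReal.coe_le_coe_iff.2 hr))

theorem exists_homDensity_le_of_homVolume_lt {r : ℝ} (h : homVolume C G < r) :
    ∃ H : Subgroup G, H.FiniteIndex ∧ ∀ K ≤ H, K.FiniteIndex → homDensity C K ≤ r := by
  simp only [homVolume_eq_iInf_iSup_homDensity, iInf_lt_iff] at h
  obtain ⟨H, hH, h⟩ := h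
  refine ⟨H, hH, fun K hKH hK => EReal.coe_le_coe_iff.1 (le_trans ?_ h.le)⟩
  exact le_iSup_of_le K (le_iSup₂_of_le hK hKH le_rfl)

theorem exists_le_homDensity_of_lt_homVolume {r : ℝ} (h : r < homVolume C G) (H : Subgroup G)
    [hH : H.FiniteIndex] : ∃ K ≤ H, K.FiniteIndex ∧ r ≤ homDensity C K := by
  rw [homVolume_eq_iInf_iSup_homDensity] at h
  have hsup := h.trans_le (iInf₂_le H hH)
  simp only [lt_iSup_iff] at hsup
  obtain ⟨K, hK, hKH, hr⟩ := hsup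
  exact ⟨K, hKH, hK, EReal.coe_le_coe_iff.1 hr.le⟩

theorem exists_coe_eq_homVolume [Finite C] [Nontrivial C] [Group.FG G] :
    ∃ r : ℝ, (r : EReal) = homVolume C G := by
  have hle : homVolume C G ≤ (Group.rank G : ℝ) :=
    homVolume_le ⊤ fun K _ _ => homDensity_le_rank C K
  have hge : ((-1 : ℝ) : EReal) ≤ homVolume C G :=
    le_homVolume fun H hH => ⟨H, le_rfl, hH, neg_one_le_homDensity C H⟩
  exact ⟨_, EReal.coe_toReal (hle.trans_lt (EReal.coe_lt_top _)).ne
    ((EReal.bot_lt_coe _).trans_le hge).ne'⟩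

end Volume

namespace GraphOfGroups

variable {V : Type uV} {E : Type uE} [Fintype V] [Fintype E]
  {𝒢 : GraphOfGroups.{uV, uE, uG, uF} V E} {T : Set E} [∀ v, Group.FG (𝒢.vertexGroup v)]
  {C : Type*} [Group C] [Finite C] [Nontrivial C] {r : V → ℝ}

open HomSystem

theorem homVolume_fundGroup_le (hT : 𝒢.IsMaximalTree T) (hsep : 𝒢.IsEdgeSeparated)
    (hr : ∀ v, homVolume C (𝒢.vertexGroup v) < r v) :
    homVolume C (𝒢.FundGroup T) ≤ (∑ v, r v + ∑ e, (1 : ℝ) / Nat.card (𝒢.edgeGroup e) : ℝ) := by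
  choose H hH hHr using fun v => exists_homDensity_le_of_homVolume_lt (hr v)
  obtain ⟨M, _, _, hMH, hM⟩ := hsep.exists_normal_comap_le hT H
  have := hM.finite_edgeGroup
  refine homVolume_le M fun K hKM hK => ?_
  let X := 𝒢.FundGroup T ⧸ K
  have : Fintype X := Fintype.ofFinite X
  let ρ : 𝒢.FundGroup T →* Equiv.Perm X := MulAction.toPermHom _ _
  have hρ (x : X) : ∃ g : 𝒢.FundGroup T, pointStabilizer ρ x = MulAut.conj g • K :=
    exists_stabilizer_quotient_eq_conj_smul x
  have hρM (x : X) : pointStabilizer ρ x ≤ M := by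
    obtain ⟨g, hg⟩ := hρ x
    exact hg.trans_le (conj_smul_le_of_le hKM g)
  have hvertex (v : V) (x : X) :
      homDensity C (pointStabilizer (ρ.comp (𝒢.vertexHom T v)) x) ≤ r v :=
    hHr v _ ((Subgroup.comap_mono (hρM x)).trans (hMH v)) inferInstance
  have hdensity (x : X) : homDensity C (pointStabilizer ρ x) = homDensity C K := by
    obtain ⟨g, hg⟩ := hρ x
    rw [hg, homDensity_conj_smul]
  refine le_of_mul_le_mul_left ?_ (Nat.cast_pos.2 (Fintype.card_pos (α := X)))
  calc (Fintype.card X : ℝ) * homDensity C K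
      = ∑ x, homDensity C (pointStabilizer ρ x) := by simp [hdensity]
    _ = ∑ v, ∑ x, homDensity C (pointStabilizer (ρ.comp (𝒢.vertexHom T v)) x) +
          Fintype.card X * ∑ e, (1 : ℝ) / Nat.card (𝒢.edgeGroup e) :=
        sum_homDensity_fundGroup hT (hM.edgeFree fun v x => Subgroup.comap_mono (hρM x))
    _ ≤ ∑ v, ∑ _x : X, r v + Fintype.card X * ∑ e, (1 : ℝ) / Nat.card (𝒢.edgeGroup e) := by
        gcongr with v _ x
        exact hvertex v x
    _ = Fintype.card X * (∑ v, r v + ∑ e, (1 : ℝ) / Nat.card (𝒢.edgeGroup e)) := by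
        simp [mul_add, Finset.mul_sum]

theorem le_homVolume_fundGroup (hT : 𝒢.IsMaximalTree T) (hsep : 𝒢.IsEdgeSeparated)
    (hr : ∀ v, r v < homVolume C (𝒢.vertexGroup v)) :
    (∑ v, r v + ∑ e, (1 : ℝ) / Nat.card (𝒢.edgeGroup e) : ℝ) ≤ homVolume C (𝒢.FundGroup T) := by
  refine le_homVolume fun H _ => ?_
  obtain ⟨M₀, _, _, -, hM₀⟩ := hsep.exists_normal_comap_le hT fun _ => ⊤
  let M := H.normalCore ⊓ M₀
  have hM : 𝒢.SeparatesEdges fun v => M.comap (𝒢.vertexHom T v) :=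
    hM₀.mono fun v => Subgroup.comap_mono inf_le_right
  have := hM.finite_edgeGroup
  choose K hKM hK hKr using fun v =>
    exists_le_homDensity_of_lt_homVolume (hr v) (M.comap (𝒢.vertexHom T v))
  obtain ⟨X, _, _, ρ, hρM, hρK⟩ := exists_perm_pointStabilizer hT M hM hKM
  have : Fintype X := Fintype.ofFinite X
  have hvertex (v : V) (x : X) :
      homDensity C (pointStabilizer (ρ.comp (𝒢.vertexHom T v)) x) = homDensity C (K v) := by
    obtain ⟨g, hg⟩ := hρK v x
    rw [hg, homDensity_conj_smul]
  have hsum : ∑ _x : X, (∑ v, r v + ∑ e, (1 : ℝ) / Nat.card (𝒢.edgeGroup e)) ≤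
      ∑ x, homDensity C (pointStabilizer ρ x) :=
    calc ∑ _x : X, (∑ v, r v + ∑ e, (1 : ℝ) / Nat.card (𝒢.edgeGroup e))
        = ∑ v, ∑ _x : X, r v + Fintype.card X * ∑ e, (1 : ℝ) / Nat.card (𝒢.edgeGroup e) := by
          simp [Finset.mul_sum]
      _ ≤ ∑ v, ∑ x, homDensity C (pointStabilizer (ρ.comp (𝒢.vertexHom T v)) x) +
            Fintype.card X * ∑ e, (1 : ℝ) / Nat.card (𝒢.edgeGroup e) := by
          gcongr with v _ x
          exact (hKr v).trans_eq (hvertex v x).symm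
      _ = ∑ x, homDensity C (pointStabilizer ρ x) :=
          (sum_homDensity_fundGroup hT
            (hM.edgeFree fun v x => Subgroup.comap_mono (hρM x))).symm
  obtain ⟨x, -, hx⟩ := Finset.exists_le_of_sum_le Finset.univ_nonempty hsum
  exact ⟨pointStabilizer ρ x, (hρM x).trans (inf_le_left.trans H.normalCore_le),
    inferInstance, hx⟩

end GraphOfGroups

theorem ereal_coe_sum {ι : Type*} (s : Finset ι) (f : ι → ℝ) :
    ((∑ i ∈ s, f i : ℝ) : EReal) = ∑ i ∈ s, (f i : EReal) :=
  map_sum (⟨⟨Real.toEReal, EReal.coe_zero⟩, EReal.coe_add⟩ : ℝ →+ EReal) f s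

theorem corollary3p11_general {V : Type uV} {E : Type uE} [Fintype V] [Fintype E]
    (𝒢 : GraphOfGroups.{uV, uE, uG, uF} V E) (T : Set E) (hT : 𝒢.IsMaximalTree T)
    (hfg : ∀ u, Group.FG (𝒢.vertexGroup u)) (hsep : 𝒢.IsEdgeSeparated)
    (C : Type*) [Group C] [Finite C] [Nontrivial C] :
    modifiedHomVolume C (𝒢.FundGroup T) =
      ∑ u, modifiedHomVolume C (𝒢.vertexGroup u) +
        ∑ e, ((1 / Nat.card (𝒢.edgeGroup e) : ℝ) : EReal) := by
  have := 𝒢.fg_fundGroup (T := T)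
  obtain ⟨a, ha⟩ := exists_coe_eq_homVolume (C := C) (G := 𝒢.FundGroup T)
  choose w hw using fun u => exists_coe_eq_homVolume (C := C) (G := 𝒢.vertexGroup u)
  simp only [modifiedHomVolume_eq_homVolume, ← ha, ← hw, ← ereal_coe_sum, ← EReal.coe_add,
    EReal.coe_eq_coe_iff]
  let f (c : ℝ) : ℝ := ∑ u, (w u + c) + ∑ e, (1 : ℝ) / Nat.card (𝒢.edgeGroup e)
  have hf : Filter.Tendsto f (𝓝 0) (𝓝 (∑ u, w u + ∑ e, (1 : ℝ) / Nat.card (𝒢.edgeGroup e))) :=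
    Continuous.tendsto' (by fun_prop) _ _ (by simp [f])
  have hupper (c : ℝ) (hc : 0 < c) : a ≤ f c := by
    rw [← EReal.coe_le_coe_iff, ha]
    refine GraphOfGroups.homVolume_fundGroup_le hT hsep fun u => ?_
    rw [← hw, EReal.coe_lt_coe_iff]
    exact lt_add_of_pos_right _ hc
  have hlower (c : ℝ) (hc : c < 0) : f c ≤ a := by
    rw [← EReal.coe_le_coe_iff, ha]
    refine GraphOfGroups.le_homVolume_fundGroup hT hsep fun u => ?_
    rw [← hw, EReal.coe_lt_coe_iff]
    exact add_lt_of_neg_right _ hc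
  exact le_antisymm
    (ge_of_tendsto (hf.mono_left nhdsWithin_le_nhds)
      (eventually_mem_nhdsWithin.mono hupper : ∀ᶠ c in 𝓝[>] 0, a ≤ f c))
    (le_of_tendsto (hf.mono_left nhdsWithin_le_nhds)
      (eventually_mem_nhdsWithin.mono hlower : ∀ᶠ c in 𝓝[<] 0, f c ≤ a))

theorem corollary3p11 {V : Type uV} {E : Type uE} [Fintype V] [Fintype E]
    (𝒢 : GraphOfGroups.{uV, uE, uG, uF} V E) (T : Set E) (hT : 𝒢.IsMaximalTree T)
    (hfg : ∀ u, Group.FG (𝒢.vertexGroup u))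
    (hvertex : ∀ u, Group.ResiduallyFinite (𝒢.vertexGroup u) ∨
      IsVirtuallyTorsionFree (𝒢.vertexGroup u))
    (hedge : ∀ e, Finite (𝒢.edgeGroup e))
    (C : Type*) [Group C] [Finite C] [Nontrivial C] :
    modifiedHomVolume C (𝒢.FundGroup T) =
      ∑ u, modifiedHomVolume C (𝒢.vertexGroup u) +
        ∑ e, ((1 / Nat.card (𝒢.edgeGroup e) : ℝ) : EReal) :=
  corollary3p11_general 𝒢 T hT hfg
    (GraphOfGroups.isEdgeSeparated_of_residuallyFinite_or_virtuallyTorsionFree hvertex) C
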